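/- Let $R$ be a commutative noetherian local ring with maximal ideal $\mathfrak m$, and let $\widehat R$ be its $\mathfrak m$-adic completion. A short exact sequence $0\to A\to B\to C\to 0$ of $R$-modules is called pure if $A\otimes_R X\to B\otimes_R X$ is injective for every $R$-module $X$, and an $R$-module $F$ is called pure-projective if $\operatorname{Hom}_R(F,B)\to\operatorname{Hom}_R(F,C)$ is surjective for every pure short exact sequence $0\to A\to B\to C\to 0$ of $R$-modules (equivalently, $F$ is isomorphic to a direct summand of a direct sum of finitely presented $R$-modules). Let $P$ and $Q$ be pure-projective $R$-modules, not necessarily finitely or countably generated. Then $P\cong Q$ as $R$-modules if and only if $P\otimes_R\widehat R\cong Q\otimes_R\widehat R$ as $\widehat R$-modules. -/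

import Mathlib

open scoped TensorProduct

universe u v w

/-- `0 → A → B → C → 0` (with maps `f`, `g`) is a pure exact sequence of `R`-modules: it is a short
exact sequence and `f ⊗ 1_X` is injective for every `R`-module `X`. -/
def IsPureShortExact {R : Type u} [CommRing R] {A B C : Type w}
    [AddCommGroup A] [AddCommGroup B] [AddCommGroup C] [Module R A] [Module R B] [Module R C]
    (f : A →ₗ[R] B) (g : B →ₗ[R] C) : Prop :=
  Function.Injective f ∧ Function.Exact f g ∧ Function.Surjective g ∧
    ∀ (X : Type (max u w)) [AddCommGroup X] [Module R X], Function.Injective (f.rTensor X)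

/-- `P` is pure-projective: `Hom(P, B) → Hom(P, C)` is surjective for every pure exact sequence
`0 → A → B → C → 0`. The sequences range over a universe that contains copies of both `R` and `P`,
so enlarging it further does not change the notion. -/
def IsPureProjective (R : Type u) [CommRing R] (P : Type v) [AddCommGroup P] [Module R P] : Prop :=
  ∀ (A B C : Type (max u v)) [AddCommGroup A] [AddCommGroup B] [AddCommGroup C]
    [Module R A] [Module R B] [Module R C] (f : A →ₗ[R] B) (g : B →ₗ[R] C),
    IsPureShortExact f g → ∀ k : P →ₗ[R] C, ∃ l : P →ₗ[R] B, g ∘ₗ l = k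

/-- The completion of a local ring in the topology of its maximal ideal. -/
abbrev LocalCompletion (R : Type u) [CommRing R] [IsLocalRing R] : Type u :=
  AdicCompletion (IsLocalRing.maximalIdeal R) R

/-! ### Purity from lifting of maps out of finitely generated modules. -/

section Purity

open LinearMap

variable {R : Type*} [CommRing R]

/-! Only the descent of an isomorphism needs an argument. Write `A` for the completion and `J` for
the maximal ideal, which lies in the Jacobson radical. A pure-projective module is a retract of a
direct sum of finitely generated modules: the tautological surjection from such a sum is pure, hence
splits.

Countably generated case. For `N` finitely presented and `A` flat, `Hom(A ⊗ N, A ⊗ Q)` is `A ⊗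
Hom(N, Q)`, and `A = R + JA`; so an isomorphism over `A` and its inverse are congruent modulo `J` to
base changes of R-linear maps `f`, `g` (`SumRetract.exists_inverseMod`). These are mutually inverse
modulo `J`, since `A` maps to `R ⧸ J`. They need not be bijective, as Nakayama fails for large
modules; but on a finitely generated submodule the identity factors through a finitely generated
module, where Nakayama applies (`SumRetract.exists_leftInverseOn`). A back-and-forth along countable
generating sequences then corrects `f` to an isomorphism (`InverseMod.nonempty_linearEquiv`).

General case. This is Kaplansky's dévissage, carried out on `P` and `Q` simultaneously. Each summand
interacts with finitely many others, through the two idempotents and through the isomorphism and its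
inverse, so sets of summands closed under interaction can be built in countable steps. A
well-ordered chain of closed sets splits `P` and `Q` into countably generated pieces whose base
changes match. -/

theorem lTensor_exact_ker_subtype (Y : Type*) {F X : Type*} [AddCommGroup F] [Module R F]
    [AddCommGroup X] [Module R X] [AddCommGroup Y] [Module R Y] {p : F →ₗ[R] X}
    (hp : Function.Surjective p) : Function.Exact (p.ker.subtype.lTensor Y) (p.lTensor Y) :=
  lTensor_exact Y p.exact_subtype_ker_map hp

/-- A short exact sequence is pure as soon as maps from finitely generated modules lift along it. -/
theorem rTensor_injective_of_forall_exists_lift {A B C : Type*}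
    [AddCommGroup A] [AddCommGroup B] [AddCommGroup C] [Module R A] [Module R B] [Module R C]
    {f : A →ₗ[R] B} {g : B →ₗ[R] C} (hf : Function.Injective f) (hfg : Function.Exact f g)
    (hlift : ∀ (n : ℕ) (N : Submodule R (Fin n → R)) (h : ((Fin n → R) ⧸ N) →ₗ[R] C),
      ∃ l : ((Fin n → R) ⧸ N) →ₗ[R] B, g ∘ₗ l = h)
    (X : Type*) [AddCommGroup X] [Module R X] : Function.Injective (f.rTensor X) := by
  classical
  rw [injective_iff_map_eq_zero]
  intro t ht
  let p : (X →₀ R) →ₗ[R] X := Finsupp.linearCombination R id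
  have hp : Function.Surjective p := Finsupp.linearCombination_surjective R Function.surjective_id
  obtain ⟨s, rfl⟩ := LinearMap.lTensor_surjective A hp t
  have hs : p.lTensor B (f.rTensor _ s) = 0 := by
    rw [← ht, ← LinearMap.comp_apply, ← LinearMap.comp_apply, LinearMap.lTensor_comp_rTensor,
      LinearMap.rTensor_comp_lTensor]
  obtain ⟨y, hy⟩ := (lTensor_exact_ker_subtype B hp _).mp hs
  obtain ⟨S, rfl⟩ := TensorProduct.exists_finset y
  let e := S.equivFin.symm
  have hsum : ∀ {Y : Type _} [AddCommMonoid Y] (φ : B × p.ker → Y),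
      ∑ i ∈ S, φ i = ∑ j, φ (e j) := fun φ ↦ by
    rw [← Finset.sum_coe_sort, ← e.sum_comp]
  let b : Fin S.card → B := fun j ↦ (e j).1.1
  let c : Fin S.card → (X →₀ R) := fun j ↦ (e j).1.2
  have hc : ∀ j, c j ∈ p.ker := fun j ↦ (e j).1.2.2
  let a : X →₀ A := TensorProduct.finsuppScalarRight R R A X s
  -- These are the coordinates, in the free module on `X`, of the image of `s` written as a sum of
  -- `b j ⊗ c j` with all `c j` in the kernel of `p`.
  have hfa : ∀ x, f (a x) = ∑ j, c j x • b j := by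
    intro x
    have h1 : TensorProduct.finsuppScalarRight R R B X (f.rTensor _ s) x = f (a x) := by
      change _ = f (TensorProduct.finsuppScalarRight R R A X s x)
      clear * -
      induction s with
      | zero => simp
      | tmul m n => simp
      | add s t hs ht => simp [hs, ht]
    rw [← h1, ← hy, map_sum, map_sum, Finsupp.finsetSum_apply, hsum]
    simp [b, c]
  let rel : X → (Fin S.card → R) := fun x j ↦ c j x
  -- Since `g ∘ f = 0`, the elements `g (b j)` satisfy the linear relations `rel x`. Lifting the
  -- resulting map gives `b' j` over `g (b j)` satisfying the same relations, so replacing `b j` by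
  -- `b j - b' j`, which comes from `A`, changes no coordinate of `s`.
  let N : Submodule R (Fin S.card → R) := Submodule.span R (Set.range rel)
  have hN : N ≤ (Fintype.linearCombination R (fun j ↦ g (b j))).ker := by
    rw [Submodule.span_le]
    rintro _ ⟨x, rfl⟩
    have := congrArg g (hfa x)
    rw [hfg.apply_apply_eq_zero, map_sum] at this
    simpa [Fintype.linearCombination_apply, rel] using this.symm
  obtain ⟨l, hl⟩ := hlift _ N (N.liftQ _ hN)
  let b' : Fin S.card → B := fun j ↦ l (N.mkQ (Pi.single j 1))
  have hb' : ∀ j, ∃ a', f a' = b j - b' j := by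
    intro j
    refine (hfg _).mp ?_
    have : g (b' j) = g (b j) := by
      have := LinearMap.congr_fun hl (N.mkQ (Pi.single j 1))
      simpa [b'] using this
    rw [map_sub, this, sub_self]
  choose a' ha' using hb'
  have hrel : ∀ x, ∑ j, c j x • b' j = 0 := by
    intro x
    have h0 : N.mkQ (rel x) = 0 := by
      simpa using! Submodule.subset_span (R := R) (Set.mem_range_self (f := rel) x)
    have h1 : rel x = ∑ j, c j x • Pi.single (M := fun _ ↦ R) j 1 := by
      ext k
      simp [rel, Finset.sum_apply, Pi.single_apply]
    rw [h1] at h0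
    have := congrArg l h0
    simpa only [map_sum, map_smul, map_zero] using this
  have hax : ∀ x, a x = ∑ j, c j x • a' j := by
    intro x
    apply hf
    rw [hfa, map_sum]
    simp only [map_smul, ha', smul_sub, Finset.sum_sub_distrib, hrel, sub_zero]
  have hs' : s = ∑ j, a' j ⊗ₜ c j := by
    apply (TensorProduct.finsuppScalarRight R R A X).injective
    ext x
    change a x = _
    rw [hax, map_sum, Finsupp.finsetSum_apply]
    simp
  rw [hs', map_sum]
  refine Finset.sum_eq_zero fun j _ ↦ ?_
  rw [LinearMap.lTensor_tmul, (LinearMap.mem_ker.mp (hc j)), TensorProduct.tmul_zero]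

end Purity

/-! ### Pure-projective modules as retracts of direct sums. -/

/-- Data exhibiting `P` as a retract of the direct sum of the modules `M i`. -/
structure SumRetract (R : Type*) [CommRing R] (P : Type*) [AddCommGroup P] [Module R P]
    {I : Type*} [DecidableEq I] (M : I → Type*) [∀ i, AddCommGroup (M i)]
    [∀ i, Module R (M i)] where
  /-- the inclusion into the direct sum -/
  toSum : P →ₗ[R] DirectSum I M
  /-- the components of the retraction -/
  gen : ∀ i, M i →ₗ[R] P
  toModule_comp_toSum : DirectSum.toModule R I P gen ∘ₗ toSum = LinearMap.id

/-- A finitely generated module `R ^ n ⧸ N` together with a map from it to `P`. -/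
structure FGIndex (R : Type u) [CommRing R] (P : Type v) [AddCommGroup P] [Module R P] :
    Type (max u v) where
  /-- the number of generators -/
  rank : ℕ
  /-- the relations -/
  rel : Submodule R (Fin rank → R)
  /-- the map to `P` -/
  hom : ((Fin rank → R) ⧸ rel) →ₗ[R] P

/-- The finitely generated module that belongs to an index. -/
abbrev FGIndex.Mod {R : Type u} [CommRing R] {P : Type v} [AddCommGroup P] [Module R P]
    (i : FGIndex R P) : Type u := (Fin i.rank → R) ⧸ i.rel

open Classical in
/-- The tautological map onto `P` from the direct sum of all finitely generated modules over `P`. -/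
noncomputable def FGIndex.cover (R : Type u) [CommRing R] (P : Type v) [AddCommGroup P]
    [Module R P] : DirectSum (FGIndex R P) FGIndex.Mod →ₗ[R] P :=
  DirectSum.toModule R (FGIndex R P) P FGIndex.hom

theorem FGIndex.exists_lift {R : Type u} [CommRing R] {P : Type v} [AddCommGroup P]
    [Module R P] (n : ℕ) (N : Submodule R (Fin n → R)) (h : ((Fin n → R) ⧸ N) →ₗ[R] P) :
    ∃ l : ((Fin n → R) ⧸ N) →ₗ[R] DirectSum (FGIndex R P) FGIndex.Mod,
      FGIndex.cover R P ∘ₗ l = h := by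
  classical
  refine ⟨DirectSum.lof R (FGIndex R P) FGIndex.Mod ⟨n, N, h⟩, LinearMap.ext fun x ↦ ?_⟩
  rw [LinearMap.comp_apply, FGIndex.cover]
  convert DirectSum.toModule_lof R (M := FGIndex.Mod) (φ := FGIndex.hom) (⟨n, N, h⟩ : FGIndex R P) x

theorem FGIndex.cover_surjective (R : Type u) [CommRing R] (P : Type v) [AddCommGroup P]
    [Module R P] : Function.Surjective (FGIndex.cover R P) := by
  intro c
  -- An element of `P` is a map from the free module of rank one.
  obtain ⟨l, hl⟩ := FGIndex.exists_lift 1 ⊥ (Submodule.liftQ _ (LinearMap.toSpanSingleton R _ c ∘ₗ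
    LinearMap.proj 0) bot_le)
  refine ⟨l (Submodule.Quotient.mk fun _ ↦ 1), ?_⟩
  rw [← LinearMap.comp_apply, hl]
  simp

/-- A surjection onto a pure-projective module splits if maps from finitely generated modules lift
along it. -/
theorem IsPureProjective.exists_section {R : Type u} [CommRing R]
    {P : Type v} [AddCommGroup P] [Module R P] (hP : IsPureProjective R P)
    {B : Type (max u v)} [AddCommGroup B] [Module R B] (q : B →ₗ[R] P) (hq : Function.Surjective q)
    (hlift : ∀ (n : ℕ) (N : Submodule R (Fin n → R)) (h : ((Fin n → R) ⧸ N) →ₗ[R] P),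
      ∃ l : ((Fin n → R) ⧸ N) →ₗ[R] B, q ∘ₗ l = h) :
    ∃ l : P →ₗ[R] B, q ∘ₗ l = LinearMap.id := by
  -- The definition of pure-projectivity tests sequences in the universe `max u v`, so `P` is moved
  -- there to serve as the quotient.
  let e : ULift.{u} P ≃ₗ[R] P := ULift.moduleEquiv
  let g : B →ₗ[R] ULift.{u} P := e.symm.toLinearMap ∘ₗ q
  have hglift : ∀ (n : ℕ) (N : Submodule R (Fin n → R))
      (h : ((Fin n → R) ⧸ N) →ₗ[R] ULift.{u} P),
      ∃ l : ((Fin n → R) ⧸ N) →ₗ[R] B, g ∘ₗ l = h := by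
    intro n N h
    obtain ⟨l, hl⟩ := hlift n N (e.toLinearMap ∘ₗ h)
    refine ⟨l, ?_⟩
    rw [LinearMap.comp_assoc, hl, ← LinearMap.comp_assoc]
    simp
  have hpure : IsPureShortExact g.ker.subtype g :=
    ⟨g.ker.injective_subtype, g.exact_subtype_ker_map, e.symm.surjective.comp hq, fun X _ _ ↦
      rTensor_injective_of_forall_exists_lift g.ker.injective_subtype g.exact_subtype_ker_map
        hglift X⟩
  obtain ⟨l, hl⟩ := hP _ _ _ _ _ hpure e.symm.toLinearMap
  exact ⟨l, LinearMap.ext fun x ↦ e.symm.injective (LinearMap.congr_fun hl x)⟩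

open Classical in
/-- A pure-projective module is a retract of a direct sum of finitely generated modules. -/
theorem IsPureProjective.nonempty_sumRetract {R : Type u} [CommRing R]
    {P : Type v} [AddCommGroup P] [Module R P] (hP : IsPureProjective R P) :
    Nonempty (SumRetract R P (FGIndex.Mod (R := R) (P := P))) := by
  obtain ⟨l, hl⟩ := hP.exists_section (B := DirectSum (FGIndex R P) FGIndex.Mod)
    (FGIndex.cover R P) (FGIndex.cover_surjective R P) FGIndex.exists_lift
  exact ⟨⟨l, FGIndex.hom, hl⟩⟩

/-- If a family of linear maps is pointwise finitely supported, then it has finite support along a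
map from a finitely generated module. -/
theorem Module.Finite.finite_setOf_comp_ne_zero {R : Type*} [CommRing R] {N P I : Type*}
    {M : I → Type*} [AddCommGroup N] [Module R N] [Module.Finite R N] [AddCommGroup P] [Module R P]
    [∀ i, AddCommGroup (M i)] [∀ i, Module R (M i)] (c : ∀ i, P →ₗ[R] M i)
    (hc : ∀ x, {i | c i x ≠ 0}.Finite) (φ : N →ₗ[R] P) : {i | c i ∘ₗ φ ≠ 0}.Finite := by
  obtain ⟨s, hs⟩ := Module.Finite.fg_top (R := R) (M := N)
  refine (s.finite_toSet.biUnion fun x _ ↦ hc (φ x)).subset fun i hi ↦ ?_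
  by_contra h
  refine hi (LinearMap.ext_on hs fun x hx ↦ ?_)
  simp only [Set.mem_iUnion, not_exists, Set.mem_ofPred_eq, not_not] at h
  simpa using h x hx

namespace SumRetract

variable {R : Type*} [CommRing R] {P Q : Type*} [AddCommGroup P] [Module R P]
  [AddCommGroup Q] [Module R Q] {I : Type*} [DecidableEq I] {M : I → Type*}
  [∀ i, AddCommGroup (M i)] [∀ i, Module R (M i)] (D : SumRetract R P M)

/-- The coordinates of the inclusion into the direct sum. -/
def coord (i : I) : P →ₗ[R] M i := DirectSum.component R I M i ∘ₗ D.toSum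

/-- The map out of `P` assembled from maps out of the summands. -/
def lift (φ : ∀ i, M i →ₗ[R] Q) : P →ₗ[R] Q := DirectSum.toModule R I Q φ ∘ₗ D.toSum

theorem lift_gen : D.lift D.gen = LinearMap.id := D.toModule_comp_toSum

theorem finite_coord_ne_zero (x : P) : {i | D.coord i x ≠ 0}.Finite :=
  DFinsupp.finite_support (D.toSum x)

theorem lift_apply (φ : ∀ i, M i →ₗ[R] Q) {x : P} {J : Finset I}
    (hJ : ∀ i ∉ J, D.coord i x = 0) : D.lift φ x = ∑ i ∈ J, φ i (D.coord i x) := by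
  have h : D.toSum x = ∑ i ∈ J, DirectSum.lof R I M i (D.coord i x) := by
    refine DFinsupp.ext fun i ↦ ?_
    rw [DFinsupp.finsetSum_apply]
    by_cases hi : i ∈ J
    · rw [Finset.sum_eq_single i]
      · exact (DFinsupp.single_eq_same).symm
      · intro j _ hj
        exact DFinsupp.single_eq_of_ne (Ne.symm hj)
      · exact fun h ↦ absurd hi h
    · rw [Finset.sum_eq_zero]
      · exact hJ i hi
      · intro j hj
        exact DFinsupp.single_eq_of_ne fun h ↦ hi (h ▸ hj)
  rw [lift, LinearMap.comp_apply, h, map_sum]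
  simp

theorem comp_lift {Z : Type*} [AddCommGroup Z] [Module R Z] (ψ : Q →ₗ[R] Z)
    (φ : ∀ i, M i →ₗ[R] Q) : ψ ∘ₗ D.lift φ = D.lift fun i ↦ ψ ∘ₗ φ i := by
  ext x
  have hJ : ∀ i ∉ (D.finite_coord_ne_zero x).toFinset, D.coord i x = 0 := by simp
  rw [LinearMap.comp_apply, D.lift_apply _ hJ, D.lift_apply _ hJ, map_sum]
  rfl

/-- Retracts inherit the structure. -/
def retract {K : Type*} [AddCommGroup K] [Module R K] (j : K →ₗ[R] P) (κ : P →ₗ[R] K)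
    (h : κ ∘ₗ j = LinearMap.id) : SumRetract R K M where
  toSum := D.toSum ∘ₗ j
  gen i := κ ∘ₗ D.gen i
  toModule_comp_toSum := by
    rw [← LinearMap.comp_assoc]
    have := D.comp_lift κ D.gen
    rw [D.lift_gen] at this
    rw [← h]
    exact congrArg (· ∘ₗ j) this.symm

/-- A finitely generated submodule of `P` is fixed by an endomorphism that factors through a
finitely generated module. -/
theorem exists_factor (D : SumRetract R P M) [∀ i, Module.Finite R (M i)] {X : Submodule R P} (hX : X.FG) :
    ∃ (J : Finset I) (r : P →ₗ[R] (∀ i : J, M i)) (e : (∀ i : J, M i) →ₗ[R] P),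
      ∀ x ∈ X, e (r x) = x := by
  have : Module.Finite R X := Module.Finite.iff_fg.mpr hX
  have hfin := Module.Finite.finite_setOf_comp_ne_zero D.coord D.finite_coord_ne_zero X.subtype
  refine ⟨hfin.toFinset, LinearMap.pi fun i ↦ D.coord i,
    ∑ i : hfin.toFinset, D.gen i ∘ₗ LinearMap.proj i, fun x hx ↦ ?_⟩
  have hJ : ∀ i ∉ hfin.toFinset, D.coord i x = 0 := by
    intro i hi
    simp only [Set.Finite.mem_toFinset, Set.mem_ofPred_eq, not_not] at hi
    exact LinearMap.congr_fun hi ⟨x, hx⟩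
  have := D.lift_apply D.gen hJ
  rw [D.lift_gen, ← Finset.sum_coe_sort] at this
  simpa using this.symm

end SumRetract

/-! ### Nakayama on finitely generated submodules, and back-and-forth. -/

section Intertwining

variable {R : Type*} [CommRing R] {J : Ideal R}

theorem LinearMap.map_mem_smul_top {P Q : Type*} [AddCommGroup P] [Module R P] [AddCommGroup Q]
    [Module R Q] (f : P →ₗ[R] Q) {x : P} (hx : x ∈ (J • ⊤ : Submodule R P)) :
    f x ∈ (J • ⊤ : Submodule R Q) :=
  Submodule.smul_top_le_comap_smul_top J f hx

/-- An endomorphism of a finitely generated module that is the identity modulo an ideal contained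
in the Jacobson radical is bijective. -/
theorem LinearMap.bijective_of_sub_mem_smul_top (hJ : J ≤ Ideal.jacobson ⊥) {N : Type*}
    [AddCommGroup N] [Module R N] [Module.Finite R N] (t : N →ₗ[R] N)
    (ht : ∀ x, t x - x ∈ (J • ⊤ : Submodule R N)) : Function.Bijective t := by
  apply OrzechProperty.bijective_of_surjective_endomorphism
  rw [← LinearMap.range_eq_top, ← top_le_iff]
  refine Submodule.le_of_le_smul_of_le_jacobson_bot Module.Finite.fg_top hJ fun x _ ↦ ?_
  rw [← sub_sub_cancel (t x) x]
  exact Submodule.sub_mem_sup (LinearMap.mem_range_self t x) (ht x)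

/-- An endomorphism that is the identity modulo `J` has, on each finitely generated submodule, a
left inverse that is the identity modulo `J`. -/
theorem SumRetract.exists_leftInverseOn (hJ : J ≤ Ideal.jacobson ⊥)
    {P : Type*} [AddCommGroup P] [Module R P] {I : Type*} [DecidableEq I] {M : I → Type*}
    [∀ i, AddCommGroup (M i)] [∀ i, Module R (M i)] [∀ i, Module.Finite R (M i)]
    (D : SumRetract R P M) (h : P →ₗ[R] P) (hh : ∀ x, h x - x ∈ (J • ⊤ : Submodule R P))
    {X : Submodule R P} (hX : X.FG) :
    ∃ k : P →ₗ[R] P, (∀ x, k x - x ∈ (J • ⊤ : Submodule R P)) ∧ ∀ x ∈ X, k (h x) = x := by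
  obtain ⟨F, r, e, hre⟩ := D.exists_factor hX
  -- This transports `h` to a finitely generated module: `t` is the identity modulo `J`, hence
  -- invertible, and `t ∘ r = r ∘ h` on `X`. So `e ∘ t⁻¹ ∘ r` undoes `h` on `X`.
  let t : (∀ i : F, M i) →ₗ[R] (∀ i : F, M i) := LinearMap.id + r ∘ₗ (h - LinearMap.id) ∘ₗ e
  have ht : ∀ y, t y - y ∈ (J • ⊤ : Submodule R (∀ i : F, M i)) := fun y ↦ by
    simpa [t] using r.map_mem_smul_top (hh (e y))
  let τ := LinearEquiv.ofBijective t (LinearMap.bijective_of_sub_mem_smul_top hJ t ht)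
  let k : P →ₗ[R] P := e ∘ₗ τ.symm.toLinearMap ∘ₗ r
  have hk : ∀ x ∈ X, k (h x) = x := by
    intro x hx
    have h1 : t (r x) = r (h x) := by simp [t, hre x hx]
    have h2 : τ.symm (r (h x)) = r x := by
      rw [LinearEquiv.symm_apply_eq, ← h1]
      rfl
    simp [k, h2, hre x hx]
  -- The map `k` need not be the identity modulo `J`. Adding `1 - h k` repairs this, because `k - h
  -- k` has values in `J • ⊤`, and `(1 - h k) h` vanishes on `X`.
  refine ⟨k + LinearMap.id - h ∘ₗ k, fun x ↦ ?_, fun x hx ↦ ?_⟩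
  · have := (J • ⊤ : Submodule R P).neg_mem (hh (k x))
    simpa [add_sub_right_comm] using this
  · simp [hk x hx]

variable {P Q : Type*} [AddCommGroup P] [Module R P] [AddCommGroup Q] [Module R Q]

/-- Two linear maps are mutually inverse modulo `J`. -/
structure InverseMod (J : Ideal R) (f : P →ₗ[R] Q) (g : Q →ₗ[R] P) : Prop where
  left : ∀ x, g (f x) - x ∈ (J • ⊤ : Submodule R P)
  right : ∀ y, f (g y) - y ∈ (J • ⊤ : Submodule R Q)

theorem InverseMod.symm {f : P →ₗ[R] Q} {g : Q →ₗ[R] P} (h : InverseMod J f g) :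
    InverseMod J g f := ⟨h.right, h.left⟩

variable {I I' : Type*} [DecidableEq I] [DecidableEq I'] {M : I → Type*} {M' : I' → Type*}
  [∀ i, AddCommGroup (M i)] [∀ i, Module R (M i)] [∀ i, Module.Finite R (M i)]
  [∀ i, AddCommGroup (M' i)] [∀ i, Module R (M' i)] [∀ i, Module.Finite R (M' i)]

theorem InverseMod.exists_leftInverseOn {f : P →ₗ[R] Q} {g : Q →ₗ[R] P} (h : InverseMod J f g)
    (hJ : J ≤ Ideal.jacobson ⊥) (D : SumRetract R P M) {X : Submodule R P} (hX : X.FG) :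
    ∃ g' : Q →ₗ[R] P, InverseMod J f g' ∧ ∀ x ∈ X, g' (f x) = x := by
  obtain ⟨k, hk, hkX⟩ := D.exists_leftInverseOn hJ (g ∘ₗ f) h.left hX
  refine ⟨k ∘ₗ g, ⟨fun x ↦ ?_, fun y ↦ ?_⟩, hkX⟩
  · rw [← sub_add_sub_cancel _ (g (f x)) x]
    exact Submodule.add_mem _ (hk _) (h.left x)
  · rw [← sub_add_sub_cancel _ (f (g y)) y]
    refine Submodule.add_mem _ ?_ (h.right y)
    rw [LinearMap.comp_apply, ← map_sub]
    exact f.map_mem_smul_top (hk _)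

/-- One step of the back-and-forth construction. -/
theorem InverseMod.exists_step (hJ : J ≤ Ideal.jacobson ⊥) (D : SumRetract R P M)
    (D' : SumRetract R Q M') {f : P →ₗ[R] Q} {g : Q →ₗ[R] P} (h : InverseMod J f g)
    {X : Submodule R P} (hX : X.FG) (a : P) (b : Q) :
    ∃ (f' : P →ₗ[R] Q) (g' : Q →ₗ[R] P) (X' : Submodule R P), InverseMod J f' g' ∧ X'.FG ∧
      X ≤ X' ∧ a ∈ X' ∧ (∃ y ∈ X', f' y = b) ∧ (∀ x ∈ X, f' x = f x) ∧
      ∀ x ∈ X, g' (f x) = x := by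
  obtain ⟨g', hg', hgf⟩ := h.exists_leftInverseOn hJ D hX
  -- Taking `f'` to be a left inverse of `g'` on `f(X) + Rb` serves twice: on `X` it gives `f' x =
  -- f' (g' (f x)) = f x`, and it makes `g' b` a preimage of `b`.
  have hY : (X.map f ⊔ Submodule.span R {b}).FG :=
    (hX.map f).sup (Submodule.fg_span_singleton b)
  obtain ⟨f', hf', hfg⟩ := hg'.symm.exists_leftInverseOn hJ D' hY
  refine ⟨f', g', X ⊔ Submodule.span R {a, g' b}, hf'.symm,
    hX.sup (Submodule.fg_span (by simp)), le_sup_left,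
    le_sup_right (a := X) (Submodule.subset_span (by simp)),
    ⟨g' b, le_sup_right (a := X) (Submodule.subset_span (by simp)),
      hfg b (le_sup_right (a := X.map f) (Submodule.mem_span_singleton_self b))⟩,
    fun x hx ↦ ?_, hgf⟩
  have := hfg (f x) (le_sup_left (a := X.map f) (Submodule.mem_map_of_mem hx))
  rwa [hgf x hx] at this

/-- Countably generated retracts of direct sums of finitely generated modules are isomorphic if
they are isomorphic modulo an ideal contained in the Jacobson radical by maps that lift. -/
theorem InverseMod.nonempty_linearEquiv (hJ : J ≤ Ideal.jacobson ⊥) (D : SumRetract R P M)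
    (D' : SumRetract R Q M') {f : P →ₗ[R] Q} {g : Q →ₗ[R] P} (h : InverseMod J f g)
    {a : ℕ → P} (ha : Submodule.span R (Set.range a) = ⊤)
    {b : ℕ → Q} (hb : Submodule.span R (Set.range b) = ⊤) : Nonempty (P ≃ₗ[R] Q) := by
  let State := {s : (P →ₗ[R] Q) × (Q →ₗ[R] P) × Submodule R P //
    InverseMod J s.1 s.2.1 ∧ s.2.2.FG}
  have step : ∀ (s : State) (n : ℕ), ∃ t : State, s.1.2.2 ≤ t.1.2.2 ∧ a n ∈ t.1.2.2 ∧
      (∃ y ∈ t.1.2.2, t.1.1 y = b n) ∧ (∀ x ∈ s.1.2.2, t.1.1 x = s.1.1 x) ∧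
      ∀ x ∈ s.1.2.2, t.1.2.1 (s.1.1 x) = x := by
    rintro ⟨⟨f, g, X⟩, hs, hX⟩ n
    obtain ⟨f', g', X', h1, h2, h3⟩ := hs.exists_step hJ D D' hX (a n) (b n)
    exact ⟨⟨⟨f', g', X'⟩, h1, h2⟩, h3⟩
  choose next h_le h_a h_b h_eq h_inv using step
  let s : ℕ → State := fun n ↦ Nat.rec ⟨⟨f, g, ⊥⟩, h, Submodule.fg_bot⟩ (fun n t ↦ next t n) n
  let X : ℕ → Submodule R P := fun n ↦ (s n).1.2.2
  let F : ℕ → P →ₗ[R] Q := fun n ↦ (s n).1.1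
  have hX : Monotone X := monotone_nat_of_le_succ fun n ↦ h_le (s n) n
  have hF : ∀ {m n}, m ≤ n → ∀ x ∈ X m, F n x = F m x := by
    intro m n hmn x hx
    induction n, hmn using Nat.le_induction with
    | base => rfl
    | succ n hmn ih => rw [← ih]; exact h_eq (s n) n x (hX hmn hx)
  have hcover : ∀ x, ∃ n, x ∈ X n := by
    have : (⨆ n, X n) = ⊤ := by
      rw [← top_le_iff, ← ha, Submodule.span_le]
      rintro _ ⟨n, rfl⟩
      exact Submodule.mem_iSup_of_mem (n + 1) (h_a (s n) n)
    intro x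
    exact (Submodule.mem_iSup_of_directed X hX.directed_le).mp (this ▸ Submodule.mem_top)
  -- The maps `F n` agree on the increasing `X n`, which exhaust `P`, so they glue. Each is
  -- injective on `X n` because the next stage supplies a left inverse there.
  choose ν hν using hcover
  have hlim : ∀ {x n}, x ∈ X n → F (ν x) x = F n x := by
    intro x n hx
    rcases le_total n (ν x) with hn | hn
    · exact hF hn x hx
    · exact (hF hn x (hν x)).symm
  let Φ : P →ₗ[R] Q :=
    { toFun := fun x ↦ F (ν x) x
      map_add' := fun x y ↦ by
        have hx := hX (le_max_left (ν x) (ν y)) (hν x)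
        have hy := hX (le_max_right (ν x) (ν y)) (hν y)
        rw [hlim hx, hlim hy, hlim (add_mem hx hy), map_add]
      map_smul' := fun c x ↦ by
        rw [hlim (Submodule.smul_mem _ c (hν x)), map_smul, RingHom.id_apply] }
  refine ⟨LinearEquiv.ofBijective Φ ⟨?_, ?_⟩⟩
  · rw [injective_iff_map_eq_zero]
    intro x hx
    have := h_inv (s (ν x)) (ν x) x (hν x)
    rw [← this]
    exact (congrArg _ hx).trans (map_zero _)
  · rw [← LinearMap.range_eq_top, ← top_le_iff, ← hb, Submodule.span_le]
    rintro _ ⟨n, rfl⟩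
    obtain ⟨y, hy, hyb⟩ := h_b (s n) n
    exact ⟨y, (hlim (n := n + 1) hy).trans hyb⟩

end Intertwining

/-! ### Finite support after base change. -/

namespace SumRetract

variable {R : Type*} [CommRing R] (A : Type*) [CommRing A] [Algebra R A]
  {P Q : Type*} [AddCommGroup P] [Module R P]
  [AddCommGroup Q] [Module R Q] {I : Type*} [DecidableEq I] {M : I → Type*}
  [∀ i, AddCommGroup (M i)] [∀ i, Module R (M i)] (D : SumRetract R P M)

/-- A tensor is a finite sum of pure tensors, each meeting finitely many summands. Allowing every
larger `J'` lets the supports of two tensors be united. -/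
theorem exists_finset_baseChange (z : A ⊗[R] P) : ∃ J : Finset I, ∀ J', J ⊆ J' →
    (∀ i ∉ J', (D.coord i).baseChange A z = 0) ∧ ∀ φ : (∀ i, M i →ₗ[R] Q),
      (D.lift φ).baseChange A z =
        ∑ i ∈ J', (φ i).baseChange A ((D.coord i).baseChange A z) := by
  induction z with
  | zero => exact ⟨∅, fun J' _ ↦ ⟨by simp, by simp⟩⟩
  | tmul a x =>
    refine ⟨(D.finite_coord_ne_zero x).toFinset, fun J' hJ' ↦ ?_⟩
    have h : ∀ i ∉ J', D.coord i x = 0 := fun i hi ↦ by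
      by_contra h
      exact hi (hJ' (by simpa using h))
    refine ⟨fun i hi ↦ by simp [h i hi], fun φ ↦ ?_⟩
    simp [D.lift_apply φ h, TensorProduct.tmul_sum]
  | add y z hy hz =>
    obtain ⟨J₁, h₁⟩ := hy
    obtain ⟨J₂, h₂⟩ := hz
    refine ⟨J₁ ∪ J₂, fun J' hJ' ↦ ?_⟩
    obtain ⟨h₁, h₁'⟩ := h₁ J' (Finset.union_subset_left hJ')
    obtain ⟨h₂, h₂'⟩ := h₂ J' (Finset.union_subset_right hJ')
    refine ⟨fun i hi ↦ by simp [h₁ i hi, h₂ i hi], fun φ ↦ ?_⟩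
    simp [h₁', h₂', Finset.sum_add_distrib]

theorem finite_coord_baseChange_ne_zero (z : A ⊗[R] P) :
    {i | (D.coord i).baseChange A z ≠ 0}.Finite := by
  obtain ⟨J, hJ⟩ := D.exists_finset_baseChange (Q := P) A z
  refine J.finite_toSet.subset fun i hi ↦ ?_
  by_contra h
  exact hi ((hJ J subset_rfl).1 i h)

theorem lift_baseChange_apply (φ : ∀ i, M i →ₗ[R] Q) {z : A ⊗[R] P} {J : Finset I}
    (hJ : ∀ i ∉ J, (D.coord i).baseChange A z = 0) : (D.lift φ).baseChange A z =
      ∑ i ∈ J, (φ i).baseChange A ((D.coord i).baseChange A z) := by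
  obtain ⟨J₀, h⟩ := D.exists_finset_baseChange (Q := Q) A z
  rw [(h (J ∪ J₀) Finset.subset_union_right).2 φ]
  refine (Finset.sum_subset Finset.subset_union_left fun i _ hi ↦ ?_).symm
  rw [hJ i hi, map_zero]

theorem eq_sum_baseChange {z : A ⊗[R] P} {J : Finset I}
    (hJ : ∀ i ∉ J, (D.coord i).baseChange A z = 0) :
    z = ∑ i ∈ J, (D.gen i).baseChange A ((D.coord i).baseChange A z) := by
  rw [← D.lift_baseChange_apply A D.gen hJ, D.lift_gen]
  simp

end SumRetract

/-! ### Approximating maps over the completion by maps over the ring. -/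

section Approximation

variable {R : Type*} [CommRing R] {A : Type*} [CommRing A] [Algebra R A] {J : Ideal R}

theorem smul_mem_smul_top {V : Type*} [AddCommGroup V] [Module R V] [Module A V]
    [IsScalarTower R A V] (a : A) {z : V} (hz : z ∈ (J • ⊤ : Submodule R V)) :
    a • z ∈ (J • ⊤ : Submodule R V) :=
  (Algebra.lsmul R R V a).map_mem_smul_top hz

/-- Elements of `J • ⊤ ⊆ A` act into `J • ⊤`. -/
theorem smul_mem_smul_top_of_mem {V : Type*} [AddCommGroup V] [Module R V] [Module A V]
    [IsScalarTower R A V] {a : A} (ha : a ∈ (J • ⊤ : Submodule R A)) (z : V) :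
    a • z ∈ (J • ⊤ : Submodule R V) :=
  (LinearMap.toSpanSingleton A V z |>.restrictScalars R).map_mem_smul_top ha

theorem smul_sub_smul_eq {V : Type*} [AddCommGroup V] [Module R V] [Module A V]
    [IsScalarTower R A V] (a : A) (r : R) (x y : V) :
    a • x - r • y = a • (x - y) + (a - algebraMap R A r) • y := by
  rw [smul_sub, sub_smul, algebraMap_smul]
  abel

/-- Over a noetherian ring, if `A` is flat and every element of `A` is congruent modulo `J` to an
element of `R`, then maps out of the base change of a finitely generated module are congruent
modulo `J` to base changes of maps. -/
theorem exists_baseChange_congr [IsNoetherianRing R] [Module.Flat R A]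
    (hA : ∀ a : A, ∃ r : R, a - algebraMap R A r ∈ (J • ⊤ : Submodule R A))
    {N Q : Type*} [AddCommGroup N] [Module R N] [Module.Finite R N] [AddCommGroup Q] [Module R Q]
    (α : A ⊗[R] N →ₗ[A] A ⊗[R] Q) : ∃ h : N →ₗ[R] Q,
      ∀ z, α z - h.baseChange A z ∈ (J • ⊤ : Submodule R (A ⊗[R] Q)) := by
  have : Module.FinitePresentation R N := Module.finitePresentation_of_finite R N
  -- By flatness and finite presentation, every `α` is an `A`-combination of base changes; each
  -- coefficient is then replaced by an element of `R` congruent to it.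
  induction α using (Module.FinitePresentation.isBaseChange_map R N Q A).inductionOn with
  | zero => exact ⟨0, fun z ↦ by simp⟩
  | tmul h => exact ⟨h, fun z ↦ by simp [LinearMap.baseChangeHom]⟩
  | smul a α ih =>
    obtain ⟨h, hh⟩ := ih
    obtain ⟨r, hr⟩ := hA a
    refine ⟨r • h, fun z ↦ ?_⟩
    have : (a • α) z - (r • h).baseChange A z = a • (α z - h.baseChange A z) +
        (a - algebraMap R A r) • h.baseChange A z := by
      rw [LinearMap.baseChange_smul, LinearMap.smul_apply, LinearMap.smul_apply]
      exact smul_sub_smul_eq a r _ _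
    rw [this]
    exact add_mem (smul_mem_smul_top a (hh z)) (smul_mem_smul_top_of_mem hr _)
  | add α β hα hβ =>
    obtain ⟨h, hh⟩ := hα
    obtain ⟨k, hk⟩ := hβ
    refine ⟨h + k, fun z ↦ ?_⟩
    rw [LinearMap.baseChange_add, LinearMap.add_apply, LinearMap.add_apply, add_sub_add_comm]
    exact add_mem (hh z) (hk z)

/-- The approximations on the individual summands are assembled by `D.lift`; no compatibility
between them is needed, since only finitely many meet a given tensor. -/
theorem SumRetract.exists_baseChange_congr [IsNoetherianRing R] [Module.Flat R A]
    (hA : ∀ a : A, ∃ r : R, a - algebraMap R A r ∈ (J • ⊤ : Submodule R A))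
    {P Q : Type*} [AddCommGroup P] [Module R P] [AddCommGroup Q] [Module R Q] {I : Type*}
    [DecidableEq I] {M : I → Type*} [∀ i, AddCommGroup (M i)] [∀ i, Module R (M i)]
    [∀ i, Module.Finite R (M i)] (D : SumRetract R P M) (α : A ⊗[R] P →ₗ[A] A ⊗[R] Q) :
    ∃ h : P →ₗ[R] Q, ∀ z, α z - h.baseChange A z ∈ (J • ⊤ : Submodule R (A ⊗[R] Q)) := by
  choose φ hφ using fun i ↦ _root_.exists_baseChange_congr hA (α ∘ₗ (D.gen i).baseChange A)
  refine ⟨D.lift φ, fun z ↦ ?_⟩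
  have hJ : ∀ i ∉ (D.finite_coord_baseChange_ne_zero A z).toFinset,
    (D.coord i).baseChange A z = 0 := by simp
  rw [D.lift_baseChange_apply A φ hJ]
  nth_rw 1 [D.eq_sum_baseChange A hJ]
  rw [map_sum, ← Finset.sum_sub_distrib]
  exact sum_mem fun i _ ↦ hφ i _

/-- If `R ⧸ J` is an `A`-algebra compatibly with `R`, then membership in `J • ⊤` descends. -/
theorem mem_smul_top_of_one_tmul_mem (ρ : A →ₐ[R] R ⧸ J) {P : Type*} [AddCommGroup P] [Module R P]
    {x : P} (hx : (1 : A) ⊗ₜ[R] x ∈ (J • ⊤ : Submodule R (A ⊗[R] P))) :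
    x ∈ (J • ⊤ : Submodule R P) := by
  let θ : A ⊗[R] P →ₗ[R] P ⧸ (J • ⊤ : Submodule R P) :=
    (TensorProduct.quotTensorEquivQuotSMul P J).toLinearMap ∘ₗ ρ.toLinearMap.rTensor P
  have h := θ.map_mem_smul_top hx
  have h0 : (J • ⊤ : Submodule R (P ⧸ (J • ⊤ : Submodule R P))) = ⊥ := by
    rw [eq_bot_iff, Submodule.smul_le]
    intro r hr y _
    obtain ⟨y, rfl⟩ := Submodule.mkQ_surjective _ y
    rw [Submodule.mem_bot, ← map_smul]
    exact (Submodule.Quotient.mk_eq_zero _).mpr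
      (Submodule.smul_mem_smul hr (Submodule.mem_top (x := y)))
  rw [h0, Submodule.mem_bot] at h
  have h1 : θ (1 ⊗ₜ x) = Submodule.Quotient.mk x := by
    simp only [θ, LinearMap.comp_apply, LinearMap.rTensor_tmul, AlgHom.toLinearMap_apply, map_one]
    simp
  rw [h1] at h
  simpa using h

/-- An isomorphism of base changes gives maps that are mutually inverse modulo `J`. -/
theorem SumRetract.exists_inverseMod [IsNoetherianRing R] [Module.Flat R A]
    (hA : ∀ a : A, ∃ r : R, a - algebraMap R A r ∈ (J • ⊤ : Submodule R A)) (ρ : A →ₐ[R] R ⧸ J)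
    {P Q I I' : Type*} [AddCommGroup P] [Module R P] [AddCommGroup Q] [Module R Q]
    [DecidableEq I] {M : I → Type*} [∀ i, AddCommGroup (M i)] [∀ i, Module R (M i)]
    [∀ i, Module.Finite R (M i)] (D : SumRetract R P M)
    [DecidableEq I'] {M' : I' → Type*} [∀ i, AddCommGroup (M' i)] [∀ i, Module R (M' i)]
    [∀ i, Module.Finite R (M' i)] (D' : SumRetract R Q M')
    (Φ : (A ⊗[R] P) ≃ₗ[A] (A ⊗[R] Q)) :
    ∃ (f : P →ₗ[R] Q) (g : Q →ₗ[R] P), InverseMod J f g := by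
  obtain ⟨f, hf⟩ := D.exists_baseChange_congr (J := J) hA Φ.toLinearMap
  obtain ⟨g, hg⟩ := D'.exists_baseChange_congr (J := J) hA Φ.symm.toLinearMap
  refine ⟨f, g, fun x ↦ mem_smul_top_of_one_tmul_mem ρ ?_,
    fun y ↦ mem_smul_top_of_one_tmul_mem ρ ?_⟩
  -- Telescoping: `Φ⁻¹Φ - gf = (Φ⁻¹ - g)Φ + g(Φ - f)` on `1 ⊗ x`.
  · have h1 := hg (Φ (1 ⊗ₜ x))
    have h2 := (g.baseChange A |>.restrictScalars R).map_mem_smul_top (hf (1 ⊗ₜ x))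
    have := neg_mem (add_mem h1 h2)
    simpa [TensorProduct.tmul_sub] using this
  · have h1 := hf (Φ.symm (1 ⊗ₜ y))
    have h2 := (f.baseChange A |>.restrictScalars R).map_mem_smul_top (hg (1 ⊗ₜ y))
    have := neg_mem (add_mem h1 h2)
    simpa [TensorProduct.tmul_sub] using this

end Approximation

/-- Every element of the completion is congruent to an element of the ring. -/
theorem AdicCompletion.exists_sub_algebraMap_mem {R : Type*} [CommRing R] {J : Ideal R}
    (hJ : J.FG) (a : AdicCompletion J R) :
    ∃ r : R, a - algebraMap R (AdicCompletion J R) r ∈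
      (J • ⊤ : Submodule R (AdicCompletion J R)) := by
  obtain ⟨r, hr⟩ := Submodule.mkQ_surjective _ (AdicCompletion.eval J R 1 a)
  refine ⟨r, ?_⟩
  refine Submodule.smul_mono_left (pow_one J).le ?_
  rw [AdicCompletion.pow_smul_top_eq_ker_eval (M := R) (n := 1) hJ, LinearMap.mem_ker, map_sub,
    ← hr, sub_eq_zero]
  rfl

/-- The countably generated case. -/
theorem SumRetract.nonempty_linearEquiv_of_countable {R : Type*} [CommRing R] [IsNoetherianRing R]
    {J : Ideal R} (hJ : J ≤ Ideal.jacobson ⊥)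
    {P Q I I' : Type*} [AddCommGroup P] [Module R P] [AddCommGroup Q] [Module R Q]
    [DecidableEq I] {M : I → Type*} [∀ i, AddCommGroup (M i)] [∀ i, Module R (M i)]
    [∀ i, Module.Finite R (M i)] (D : SumRetract R P M)
    [DecidableEq I'] {M' : I' → Type*} [∀ i, AddCommGroup (M' i)] [∀ i, Module R (M' i)]
    [∀ i, Module.Finite R (M' i)] (D' : SumRetract R Q M')
    {s : Set P} (hs : s.Countable) (hs' : Submodule.span R s = ⊤)
    {t : Set Q} (ht : t.Countable) (ht' : Submodule.span R t = ⊤)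
    (Φ : (AdicCompletion J R ⊗[R] P) ≃ₗ[AdicCompletion J R] (AdicCompletion J R ⊗[R] Q)) :
    Nonempty (P ≃ₗ[R] Q) := by
  obtain ⟨f, g, h⟩ := D.exists_inverseMod (A := AdicCompletion J R)
    (AdicCompletion.exists_sub_algebraMap_mem (IsNoetherian.noetherian J))
    (AdicCompletion.evalOneₐ J) D' Φ
  -- Inserting `0` makes the set nonempty, hence the range of a sequence, without changing its span.
  obtain ⟨a, ha⟩ := (hs.insert 0).exists_eq_range (Set.insert_nonempty _ _)
  obtain ⟨b, hb⟩ := (ht.insert 0).exists_eq_range (Set.insert_nonempty _ _)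
  refine h.nonempty_linearEquiv hJ D D' (a := a) (b := b) ?_ ?_
  · rw [← ha, Submodule.span_insert_zero, hs']
  · rw [← hb, Submodule.span_insert_zero, ht']

/-! ### Stable sets of summands and the pieces between them. -/

namespace SumRetract

variable {R : Type*} [CommRing R] (A : Type*) [CommRing A] [Algebra R A]
  {P Q : Type*} [AddCommGroup P] [Module R P]
  [AddCommGroup Q] [Module R Q] {I : Type*} [DecidableEq I] {M : I → Type*}
  [∀ i, AddCommGroup (M i)] [∀ i, Module R (M i)] (D : SumRetract R P M)

open Classical in
/-- The endomorphism of `P` induced by the projection of the direct sum onto the summands in `S`. -/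
noncomputable def proj (S : Set I) : P →ₗ[R] P := D.lift fun i ↦ if i ∈ S then D.gen i else 0

theorem proj_ext {S : Set I} {φ ψ : P →ₗ[R] Q} (h : ∀ i ∈ S, φ ∘ₗ D.gen i = ψ ∘ₗ D.gen i) :
    φ ∘ₗ D.proj S = ψ ∘ₗ D.proj S := by
  classical
  rw [proj, comp_lift, comp_lift]
  congr 1
  funext i
  split_ifs with hi
  · exact h i hi
  · simp

theorem proj_baseChange_ext {S : Set I} {Z : Type*} [AddCommGroup Z] [Module A Z]
    {φ ψ : A ⊗[R] P →ₗ[A] Z}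
    (h : ∀ i ∈ S, φ ∘ₗ (D.gen i).baseChange A = ψ ∘ₗ (D.gen i).baseChange A) :
    φ ∘ₗ (D.proj S).baseChange A = ψ ∘ₗ (D.proj S).baseChange A := by
  classical
  refine LinearMap.ext fun z ↦ ?_
  have hJ : ∀ i ∉ (D.finite_coord_baseChange_ne_zero A z).toFinset,
    (D.coord i).baseChange A z = 0 := by simp
  rw [LinearMap.comp_apply, LinearMap.comp_apply, proj, D.lift_baseChange_apply A _ hJ, map_sum,
    map_sum]
  refine Finset.sum_congr rfl fun i _ ↦ ?_
  split_ifs with hi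
  · exact LinearMap.congr_fun (h i hi) _
  · simp

theorem proj_univ : D.proj Set.univ = LinearMap.id := by
  simp [proj, D.lift_gen]

theorem proj_apply_of_coord_eq_zero {S : Set I} {x : P} (h : ∀ i ∉ S, D.coord i x = 0) :
    D.proj S x = x := by
  classical
  have hJ : ∀ i ∉ (D.finite_coord_ne_zero x).toFinset, D.coord i x = 0 := by simp
  conv_rhs => rw [← LinearMap.id_apply (R := R) x, ← D.lift_gen, D.lift_apply _ hJ]
  rw [proj, D.lift_apply _ hJ]
  refine Finset.sum_congr rfl fun i _ ↦ ?_
  split_ifs with hi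
  · rfl
  · rw [h i hi, map_zero, map_zero]

theorem proj_baseChange_apply_of_coord_eq_zero {S : Set I} {z : A ⊗[R] P}
    (h : ∀ i ∉ S, (D.coord i).baseChange A z = 0) : (D.proj S).baseChange A z = z := by
  classical
  have hJ : ∀ i ∉ (D.finite_coord_baseChange_ne_zero A z).toFinset,
    (D.coord i).baseChange A z = 0 := by simp
  conv_rhs => rw [D.eq_sum_baseChange A hJ]
  rw [proj, D.lift_baseChange_apply A _ hJ]
  refine Finset.sum_congr rfl fun i _ ↦ ?_
  split_ifs with hi
  · rfl
  · rw [h i hi, map_zero, map_zero]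

/-- The image of the summands in `S` is preserved by the idempotent that defines `P`. -/
def IsStable (S : Set I) : Prop := ∀ i ∈ S, ∀ j, D.coord j ∘ₗ D.gen i ≠ 0 → j ∈ S

variable {D}

/-- Stability keeps the coordinates of `D.gen i m` inside `S`. This is what makes `D.proj S`
idempotent; for arbitrary `S` it need not be. -/
theorem IsStable.proj_comp_gen {S : Set I} (hS : D.IsStable S) {i : I} (hi : i ∈ S) :
    D.proj S ∘ₗ D.gen i = D.gen i := by
  refine LinearMap.ext fun m ↦ D.proj_apply_of_coord_eq_zero fun j hj ↦ ?_
  by_contra h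
  exact hj (hS i hi j fun h0 ↦ h (LinearMap.congr_fun h0 m))

theorem IsStable.proj_comp_proj {S T : Set I} (hT : D.IsStable T) (hST : S ⊆ T) :
    D.proj T ∘ₗ D.proj S = D.proj S :=
  (D.proj_ext fun _ hi ↦ (hT.proj_comp_gen (hST hi)).trans (LinearMap.id_comp _).symm).trans
    (LinearMap.id_comp _)

theorem IsStable.proj_proj {S T : Set I} (hT : D.IsStable T) (hST : S ⊆ T) (x : P) :
    D.proj T (D.proj S x) = D.proj S x :=
  LinearMap.congr_fun (hT.proj_comp_proj hST) x

variable (D) in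
/-- A complement of the range of `D.proj S` in the range of `D.proj T`. -/
noncomputable def piece (S T : Set I) : Submodule R P := (D.proj S).ker ⊓ (D.proj T - LinearMap.id).ker

theorem mem_piece {S T : Set I} {x : P} : x ∈ D.piece S T ↔ D.proj S x = 0 ∧ D.proj T x = x := by
  simp [piece, sub_eq_zero]

/-- The retraction of `P` onto a piece. -/
noncomputable def pieceProj {S T : Set I} (hS : D.IsStable S) (hT : D.IsStable T) (hST : S ⊆ T) :
    P →ₗ[R] D.piece S T :=
  (D.proj T - D.proj S ∘ₗ D.proj T).codRestrict _ fun x ↦ by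
    simp [mem_piece, hS.proj_proj subset_rfl, hT.proj_proj subset_rfl, hT.proj_proj hST]

section Piece

variable {S T : Set I} (hS : D.IsStable S) (hT : D.IsStable T) (hST : S ⊆ T)

theorem coe_pieceProj (x : P) :
    (pieceProj hS hT hST x : P) = D.proj T x - D.proj S (D.proj T x) := rfl

theorem pieceProj_comp_subtype :
    pieceProj hS hT hST ∘ₗ (D.piece S T).subtype = LinearMap.id := by
  refine LinearMap.ext fun x ↦ Subtype.ext ?_
  obtain ⟨h1, h2⟩ := mem_piece.mp x.2
  simp [coe_pieceProj, h1, h2]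

theorem pieceProj_comp_proj_left : pieceProj hS hT hST ∘ₗ D.proj S = 0 := by
  refine LinearMap.ext fun x ↦ Subtype.ext ?_
  simp [coe_pieceProj, hT.proj_proj hST, hS.proj_proj subset_rfl]

/-- A piece is countably generated if it involves countably many summands. -/
theorem exists_countable_span_piece [∀ i, Module.Finite R (M i)] (hS : D.IsStable S)
    (hT : D.IsStable T) (hST : S ⊆ T) (hc : (T \ S).Countable) :
    ∃ s : Set (D.piece S T), s.Countable ∧ Submodule.span R s = ⊤ := by
  let κ := pieceProj hS hT hST
  have hfg : ∀ i, ∃ s : Set (D.piece S T), s.Finite ∧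
      Submodule.span R s = (κ ∘ₗ D.gen i).range := by
    intro i
    have := (Module.Finite.fg_top (R := R) (M := M i)).map (κ ∘ₗ D.gen i)
    rw [Submodule.map_top] at this
    exact Submodule.fg_def.mp this
  choose s hs hs' using hfg
  refine ⟨⋃ i ∈ T \ S, s i, hc.biUnion fun i _ ↦ (hs i).countable, ?_⟩
  set N := Submodule.span R (⋃ i ∈ T \ S, s i) with hN
  -- It suffices to test on the summands in `T`: those in `S` are killed by `κ`, the others land in
  -- `N` by construction.
  have h : (N.mkQ ∘ₗ κ) ∘ₗ D.proj T = 0 ∘ₗ D.proj T := by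
    refine D.proj_ext fun i hi ↦ LinearMap.ext fun m ↦ ?_
    by_cases hiS : i ∈ S
    · have : κ (D.gen i m) = 0 := by
        rw [← hS.proj_comp_gen hiS]
        exact LinearMap.congr_fun (pieceProj_comp_proj_left hS hT hST) _
      simp [this]
    · have hm : κ (D.gen i m) ∈ N := by
        have h1 : (κ ∘ₗ D.gen i).range ≤ N := by
          rw [← hs' i]
          exact Submodule.span_mono (Set.subset_biUnion_of_mem (u := s) (⟨hi, hiS⟩ : i ∈ T \ S))
        exact h1 (LinearMap.mem_range_self (κ ∘ₗ D.gen i) m)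
      simpa using hm
  rw [eq_top_iff]
  intro x _
  have h1 := LinearMap.congr_fun h (x : P)
  have h2 : κ (D.proj T x) = x := by
    rw [(mem_piece.mp x.2).2]
    exact LinearMap.congr_fun (pieceProj_comp_subtype hS hT hST) x
  simpa [h2] using h1

end Piece

section BaseChange

variable {I' : Type*} [DecidableEq I'] {M' : I' → Type*}
  [∀ i, AddCommGroup (M' i)] [∀ i, Module R (M' i)] {D' : SumRetract R Q M'}

theorem proj_baseChange_comp_of_coord {S : Set I} {S' : Set I'} {Φ : A ⊗[R] P →ₗ[A] A ⊗[R] Q}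
    (h : ∀ i ∈ S, ∀ j, (D'.coord j).baseChange A ∘ₗ Φ ∘ₗ (D.gen i).baseChange A ≠ 0 → j ∈ S')
    (z : A ⊗[R] P) : (D'.proj S').baseChange A (Φ ((D.proj S).baseChange A z)) =
      Φ ((D.proj S).baseChange A z) := by
  have : ((D'.proj S').baseChange A ∘ₗ Φ) ∘ₗ (D.proj S).baseChange A =
      Φ ∘ₗ (D.proj S).baseChange A := by
    refine D.proj_baseChange_ext A fun i hi ↦ LinearMap.ext fun y ↦ ?_
    refine D'.proj_baseChange_apply_of_coord_eq_zero A fun j hj ↦ ?_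
    by_contra hne
    exact hj (h i hi j fun h0 ↦ hne (LinearMap.congr_fun h0 y))
  exact LinearMap.congr_fun this z

variable {S T : Set I} {S' T' : Set I'}
  (hS : D.IsStable S) (hT : D.IsStable T) (hST : S ⊆ T)
  (hS' : D'.IsStable S') (hT' : D'.IsStable T') (hST' : S' ⊆ T')

/-- A piece is the range of `D.proj T` modulo that of `D.proj S`. Passing through the other piece
changes `Φ w` only by a term from `S'`, which `Φ.symm` sends to a term from `S`, killed by
`pieceProj`. -/
theorem pieceProj_baseChange_inverse (Φ : (A ⊗[R] P) ≃ₗ[A] (A ⊗[R] Q))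
    (hΦT : ∀ z, (D'.proj T').baseChange A (Φ ((D.proj T).baseChange A z)) =
      Φ ((D.proj T).baseChange A z))
    (hΦS : ∀ z, (D.proj S).baseChange A (Φ.symm ((D'.proj S').baseChange A z)) =
      Φ.symm ((D'.proj S').baseChange A z)) (z : A ⊗[R] D.piece S T) :
    (pieceProj hS hT hST).baseChange A (Φ.symm ((D'.piece S' T').subtype.baseChange A
      ((pieceProj hS' hT' hST').baseChange A (Φ ((D.piece S T).subtype.baseChange A z))))) = z := by
  have h1 : (D'.piece S' T').subtype ∘ₗ pieceProj hS' hT' hST' =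
    D'.proj T' - D'.proj S' ∘ₗ D'.proj T' := rfl
  have h2 : D.proj T ∘ₗ (D.piece S T).subtype = (D.piece S T).subtype :=
    LinearMap.ext fun x ↦ (mem_piece.mp x.2).2
  set w := (D.piece S T).subtype.baseChange A z with hw
  have hwT : (D.proj T).baseChange A w = w := by
    rw [hw, ← LinearMap.comp_apply, ← LinearMap.baseChange_comp, h2]
  have hΦw : (D'.proj T').baseChange A (Φ w) = Φ w := by
    rw [← hwT]
    exact hΦT w
  have h3 : (D'.piece S' T').subtype.baseChange A ((pieceProj hS' hT' hST').baseChange A (Φ w)) =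
      Φ w - (D'.proj S').baseChange A (Φ w) := by
    rw [← LinearMap.comp_apply, ← LinearMap.baseChange_comp, h1, LinearMap.baseChange_sub,
      LinearMap.baseChange_comp, LinearMap.sub_apply, LinearMap.comp_apply, hΦw]
  have h4 : ∀ y, (pieceProj hS hT hST).baseChange A ((D.proj S).baseChange A y) = 0 := fun y ↦ by
    rw [← LinearMap.comp_apply, ← LinearMap.baseChange_comp, pieceProj_comp_proj_left,
      LinearMap.baseChange_zero, LinearMap.zero_apply]
  rw [h3, map_sub, map_sub, ← hΦS, h4, sub_zero, LinearEquiv.symm_apply_apply, hw,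
    ← LinearMap.comp_apply, ← LinearMap.baseChange_comp, pieceProj_comp_subtype,
    LinearMap.baseChange_id, LinearMap.id_apply]

/-- An isomorphism of base changes that respects the filtrations induces isomorphisms of the base
changes of the pieces. -/
noncomputable def pieceEquiv (Φ : (A ⊗[R] P) ≃ₗ[A] (A ⊗[R] Q))
    (hΦS : ∀ z, (D'.proj S').baseChange A (Φ ((D.proj S).baseChange A z)) =
      Φ ((D.proj S).baseChange A z))
    (hΦT : ∀ z, (D'.proj T').baseChange A (Φ ((D.proj T).baseChange A z)) =
      Φ ((D.proj T).baseChange A z))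
    (hΨS : ∀ z, (D.proj S).baseChange A (Φ.symm ((D'.proj S').baseChange A z)) =
      Φ.symm ((D'.proj S').baseChange A z))
    (hΨT : ∀ z, (D.proj T).baseChange A (Φ.symm ((D'.proj T').baseChange A z)) =
      Φ.symm ((D'.proj T').baseChange A z)) :
    (A ⊗[R] D.piece S T) ≃ₗ[A] (A ⊗[R] D'.piece S' T') :=
  LinearEquiv.ofLinearMap
    ((pieceProj hS' hT' hST').baseChange A ∘ₗ Φ.toLinearMap ∘ₗ (D.piece S T).subtype.baseChange A)
    ((pieceProj hS hT hST).baseChange A ∘ₗ Φ.symm.toLinearMap ∘ₗ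
      (D'.piece S' T').subtype.baseChange A)
    (LinearMap.ext fun z ↦
      pieceProj_baseChange_inverse A hS' hT' hST' hS hT hST Φ.symm hΨT hΦS z)
    (LinearMap.ext fun z ↦
      pieceProj_baseChange_inverse A hS hT hST hS' hT' hST' Φ hΦT hΨS z)

end BaseChange

end SumRetract

/-! ### Kaplansky dévissage along a well-ordered filtration. -/

/-- Successive complements in a well-ordered filtration form a direct sum decomposition. -/
theorem DirectSum.isInternal_of_filtration {R P W : Type*} [CommRing R] [AddCommGroup P]
    [Module R P] [LinearOrder W] [WellFoundedLT W] (U V K : W → Submodule R P)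
    (hU : ∀ w, U w ≤ ⨆ v, ⨆ _ : v < w, V v) (hV : ∀ w, V w ≤ U w ⊔ K w)
    (hd : ∀ w, Disjoint (U w) (K w)) (hK : ∀ v w, v < w → K v ≤ U w) (htop : ⨆ w, V w = ⊤) :
    DirectSum.IsInternal K := by
  apply DirectSum.isInternal_submodule_of_iSupIndep_of_iSup_eq_top
  · rw [iSupIndep_iff_finsetSum_eq_zero_imp_eq_zero]
    intro s x hx hsum
    induction s using Finset.induction_on_max with
    | empty => simp
    | insert a s ha ih =>
      rw [Finset.sum_insert fun h ↦ lt_irrefl a (ha a h)] at hsum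
      -- The term of largest index is minus a sum of earlier ones, so it lies in both `U a` and `K
      -- a`.
      have hxa : x a = 0 := by
        refine Submodule.disjoint_def.mp (hd a) _ ?_ (hx a (Finset.mem_insert_self a s))
        rw [eq_neg_of_add_eq_zero_left hsum]
        exact neg_mem (sum_mem fun i hi ↦
          hK i a (ha i hi) (hx i (Finset.mem_insert_of_mem hi)))
      rw [hxa, zero_add] at hsum
      intro i hi
      rcases Finset.mem_insert.mp hi with rfl | hi
      · exact hxa
      · exact ih (fun j hj ↦ hx j (Finset.mem_insert_of_mem hj)) hsum i hi
  · rw [← top_le_iff, ← htop]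
    refine iSup_le fun w ↦ ?_
    induction w using WellFoundedLT.induction with
    | ind w ih =>
      exact (hV w).trans (sup_le ((hU w).trans (iSup₂_le ih)) (le_iSup K w))

namespace SumRetract

variable {R : Type*} [CommRing R] {P : Type*} [AddCommGroup P] [Module R P]
  {I : Type*} [DecidableEq I] {M : I → Type*}
  [∀ i, AddCommGroup (M i)] [∀ i, Module R (M i)] {D : SumRetract R P M}

theorem IsStable.biUnion {W : Type*} {c : W → Set I} (hc : ∀ w, D.IsStable (c w)) (s : Set W) :
    D.IsStable (⋃ w ∈ s, c w) := by
  intro i hi j hij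
  obtain ⟨w, hw, hi⟩ := Set.mem_iUnion₂.mp hi
  exact Set.mem_iUnion₂.mpr ⟨w, hw, hc w i hi j hij⟩

theorem range_proj_le {S : Set I} {N : Submodule R P} (h : ∀ i ∈ S, (D.gen i).range ≤ N) :
    (D.proj S).range ≤ N := by
  have : N.mkQ ∘ₗ D.proj S = 0 ∘ₗ D.proj S := D.proj_ext fun i hi ↦ LinearMap.ext fun m ↦ by
    simpa using h i hi (LinearMap.mem_range_self _ m)
  rintro _ ⟨x, rfl⟩
  simpa using LinearMap.congr_fun this x

/-- Over a well-ordered family of stable sets of summands, a retract of a direct sum decomposes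
into pieces. -/
theorem nonempty_directSum_piece_equiv {W : Type*} [LinearOrder W] [WellFoundedLT W] {c : W → Set I}
    (hc : ∀ w, D.IsStable (c w)) (hcover : ∀ i, ∃ w, i ∈ c w) :
    Nonempty (DirectSum W (fun w ↦
      D.piece (⋃ v ∈ Set.Iio w, c v) (⋃ v ∈ Set.Iic w, c v)) ≃ₗ[R] P) := by
  have hlt := fun w : W ↦ IsStable.biUnion hc (Set.Iio w)
  have hle := fun w : W ↦ IsStable.biUnion hc (Set.Iic w)
  have hsub : ∀ w : W, (⋃ v ∈ Set.Iio w, c v) ⊆ ⋃ v ∈ Set.Iic w, c v := fun w ↦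
    Set.biUnion_subset_biUnion_left Set.Iio_subset_Iic_self
  have hgen : ∀ {i w}, i ∈ c w →
      (D.gen i).range ≤ (D.proj (⋃ v ∈ Set.Iic w, c v)).range := fun {i w} hi ↦ by
    rw [← (hle w).proj_comp_gen (Set.mem_biUnion (Set.mem_Iic.mpr le_rfl) hi)]
    exact LinearMap.range_comp_le_range _ _
  refine ⟨LinearEquiv.ofBijective (DirectSum.coeLinearMap _) ?_⟩
  refine DirectSum.isInternal_of_filtration (fun w ↦ (D.proj (⋃ v ∈ Set.Iio w, c v)).range)
    (fun w ↦ (D.proj (⋃ v ∈ Set.Iic w, c v)).range) _ (fun w ↦ ?_) (fun w ↦ ?_) (fun w ↦ ?_)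
    (fun v w hvw ↦ ?_) ?_
  · refine range_proj_le fun i hi ↦ ?_
    obtain ⟨v, hv, hi⟩ := Set.mem_iUnion₂.mp hi
    exact (hgen hi).trans (le_iSup₂_of_le v hv le_rfl)
  · rintro _ ⟨x, rfl⟩
    rw [← add_sub_cancel (D.proj (⋃ v ∈ Set.Iio w, c v) (D.proj (⋃ v ∈ Set.Iic w, c v) x))
      (D.proj (⋃ v ∈ Set.Iic w, c v) x)]
    exact Submodule.add_mem_sup (LinearMap.mem_range_self _ _)
      (pieceProj (hlt w) (hle w) (hsub w) x).2
  · rw [Submodule.disjoint_def]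
    rintro _ ⟨x, rfl⟩ hx
    rw [← (hlt w).proj_proj subset_rfl]
    exact (mem_piece.mp hx).1
  · intro x hx
    rw [← (mem_piece.mp hx).2, ← (hlt w).proj_proj (Set.biUnion_subset_biUnion_left
      (Set.Iic_subset_Iio.mpr hvw))]
    exact LinearMap.mem_range_self _ _
  · rw [← top_le_iff, ← LinearMap.range_id (R := R) (M := P), ← D.proj_univ]
    refine range_proj_le fun i _ ↦ ?_
    obtain ⟨w, hw⟩ := hcover i
    exact (hgen hw).trans (le_iSup_of_le w le_rfl)

end SumRetract

/-! ### Countable closures under interaction, and the general case. -/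

/-- If each point has countably many successors, then countably many points are reachable from a
given one. -/
theorem Relation.countable_setOf_reflTransGen {W : Type*} {r : W → W → Prop}
    (hr : ∀ a, {b | r a b}.Countable) (a : W) : {b | Relation.ReflTransGen r a b}.Countable := by
  let step : ℕ → Set W := fun n ↦ Nat.rec {a} (fun _ s ↦ ⋃ x ∈ s, {b | r x b}) n
  have hstep : ∀ n, (step n).Countable := fun n ↦ by
    induction n with
    | zero => exact Set.countable_singleton a
    | succ n ih => exact ih.biUnion fun x _ ↦ hr x
  refine (Set.countable_iUnion hstep).mono fun b hb ↦ ?_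
  induction hb with
  | refl => exact Set.mem_iUnion.mpr ⟨0, rfl⟩
  | tail _ hbc ih =>
    obtain ⟨n, hn⟩ := Set.mem_iUnion.mp ih
    exact Set.mem_iUnion.mpr ⟨n + 1, Set.mem_biUnion hn hbc⟩

theorem Set.biUnion_Iic_diff_biUnion_Iio_subset {W X : Type*} [LinearOrder W] (d : W → Set X)
    (w : W) : (⋃ v ∈ Set.Iic w, d v) \ (⋃ v ∈ Set.Iio w, d v) ⊆ d w := by
  rintro x ⟨hx, hx'⟩
  obtain ⟨v, hv, hxv⟩ := Set.mem_iUnion₂.mp hx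
  rcases (Set.mem_Iic.mp hv).lt_or_eq with h | rfl
  · exact absurd (Set.mem_biUnion (Set.mem_Iio.mpr h) hxv) hx'
  · exact hxv

section Linked

variable {R : Type*} [CommRing R] (A : Type*) [CommRing A] [Algebra R A]
  {P Q : Type*} [AddCommGroup P] [Module R P] [AddCommGroup Q] [Module R Q]
  {I I' : Type*} [DecidableEq I] [DecidableEq I'] {M : I → Type*} {M' : I' → Type*}
  [∀ i, AddCommGroup (M i)] [∀ i, Module R (M i)]
  [∀ i, AddCommGroup (M' i)] [∀ i, Module R (M' i)]
  (D' : SumRetract R Q M') (D : SumRetract R P M)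

/-- The summands that are involved in the images of a summand under the idempotents defining `P`
and `Q` and under an isomorphism of base changes. -/
def SumRetract.Linked (Φ : (A ⊗[R] P) ≃ₗ[A] (A ⊗[R] Q)) : I ⊕ I' → I ⊕ I' → Prop
  | .inl i, .inl j => D.coord j ∘ₗ D.gen i ≠ 0
  | .inl i, .inr j => (D'.coord j).baseChange A ∘ₗ Φ.toLinearMap ∘ₗ (D.gen i).baseChange A ≠ 0
  | .inr i, .inl j => (D.coord j).baseChange A ∘ₗ Φ.symm.toLinearMap ∘ₗ (D'.gen i).baseChange A ≠ 0
  | .inr i, .inr j => D'.coord j ∘ₗ D'.gen i ≠ 0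

theorem SumRetract.countable_linked [∀ i, Module.Finite R (M i)] [∀ i, Module.Finite R (M' i)]
    (Φ : (A ⊗[R] P) ≃ₗ[A] (A ⊗[R] Q)) (a : I ⊕ I') :
    {b | SumRetract.Linked A D' D Φ a b}.Countable := by
  have h : ∀ s : Set (I ⊕ I'), (Sum.inl ⁻¹' s).Finite → (Sum.inr ⁻¹' s).Finite → s.Countable :=
    fun s h₁ h₂ ↦ by
      rw [← Set.image_preimage_inl_union_image_preimage_inr s]
      exact ((h₁.image _).union (h₂.image _)).countable
  rcases a with i | i
  · exact h _ (Module.Finite.finite_setOf_comp_ne_zero D.coord D.finite_coord_ne_zero (D.gen i))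
      (Module.Finite.finite_setOf_comp_ne_zero (fun j ↦ (D'.coord j).baseChange A)
        (D'.finite_coord_baseChange_ne_zero A) (Φ.toLinearMap ∘ₗ (D.gen i).baseChange A))
  · exact h _ (Module.Finite.finite_setOf_comp_ne_zero (fun j ↦ (D.coord j).baseChange A)
        (D.finite_coord_baseChange_ne_zero A) (Φ.symm.toLinearMap ∘ₗ (D'.gen i).baseChange A))
      (Module.Finite.finite_setOf_comp_ne_zero D'.coord D'.finite_coord_ne_zero (D'.gen i))

end Linked

/-- Retracts of direct sums of finitely generated modules over a noetherian ring are determined by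
their base change to the completion at an ideal contained in the Jacobson radical. -/
theorem SumRetract.nonempty_linearEquiv {R : Type*} [CommRing R] [IsNoetherianRing R]
    {J : Ideal R} (hJ : J ≤ Ideal.jacobson ⊥)
    {P Q I I' : Type*} [AddCommGroup P] [Module R P] [AddCommGroup Q] [Module R Q]
    [DecidableEq I] {M : I → Type*} [∀ i, AddCommGroup (M i)] [∀ i, Module R (M i)]
    [∀ i, Module.Finite R (M i)] (D : SumRetract R P M)
    [DecidableEq I'] {M' : I' → Type*} [∀ i, AddCommGroup (M' i)] [∀ i, Module R (M' i)]
    [∀ i, Module.Finite R (M' i)] (D' : SumRetract R Q M')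
    (Φ : (AdicCompletion J R ⊗[R] P) ≃ₗ[AdicCompletion J R] (AdicCompletion J R ⊗[R] Q)) :
    Nonempty (P ≃ₗ[R] Q) := by
  -- A single well-order on the disjoint union indexes the filtrations of both `P` and `Q`, so their
  -- pieces can be compared index by index.
  obtain ⟨_, _⟩ := exists_wellFoundedLT (I ⊕ I')
  let r := SumRetract.Linked (AdicCompletion J R) D' D Φ
  let c : I ⊕ I' → Set (I ⊕ I') := fun w ↦ {b | Relation.ReflTransGen r w b}
  have hcount : ∀ w, (c w).Countable :=
    Relation.countable_setOf_reflTransGen (SumRetract.countable_linked _ D' D Φ)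
  have hclosed : ∀ w a b, a ∈ c w → r a b → b ∈ c w := fun w a b ha hab ↦ ha.tail hab
  let c₁ : I ⊕ I' → Set I := fun w ↦ Sum.inl ⁻¹' c w
  let c₂ : I ⊕ I' → Set I' := fun w ↦ Sum.inr ⁻¹' c w
  have hc₁ : ∀ w, D.IsStable (c₁ w) := fun w i hi j hij ↦ hclosed w (.inl i) (.inl j) hi hij
  have hc₂ : ∀ w, D'.IsStable (c₂ w) := fun w i hi j hij ↦ hclosed w (.inr i) (.inr j) hi hij
  have hsub₁ : ∀ w, (⋃ v ∈ Set.Iio w, c₁ v) ⊆ ⋃ v ∈ Set.Iic w, c₁ v := fun w ↦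
    Set.biUnion_subset_biUnion_left Set.Iio_subset_Iic_self
  have hsub₂ : ∀ w, (⋃ v ∈ Set.Iio w, c₂ v) ⊆ ⋃ v ∈ Set.Iic w, c₂ v := fun w ↦
    Set.biUnion_subset_biUnion_left Set.Iio_subset_Iic_self
  have hΦ : ∀ (s : Set (I ⊕ I')) z, (D'.proj (⋃ v ∈ s, c₂ v)).baseChange (AdicCompletion J R)
      (Φ ((D.proj (⋃ v ∈ s, c₁ v)).baseChange (AdicCompletion J R) z)) =
      Φ ((D.proj (⋃ v ∈ s, c₁ v)).baseChange (AdicCompletion J R) z) := fun s z ↦ by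
    refine SumRetract.proj_baseChange_comp_of_coord _ (Φ := Φ.toLinearMap) (fun i hi j hij ↦ ?_) z
    obtain ⟨w, hw, hi⟩ := Set.mem_iUnion₂.mp hi
    exact Set.mem_biUnion hw (hclosed w (.inl i) (.inr j) hi hij)
  have hΨ : ∀ (s : Set (I ⊕ I')) z, (D.proj (⋃ v ∈ s, c₁ v)).baseChange (AdicCompletion J R)
      (Φ.symm ((D'.proj (⋃ v ∈ s, c₂ v)).baseChange (AdicCompletion J R) z)) =
      Φ.symm ((D'.proj (⋃ v ∈ s, c₂ v)).baseChange (AdicCompletion J R) z) := fun s z ↦ by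
    refine SumRetract.proj_baseChange_comp_of_coord _ (Φ := Φ.symm.toLinearMap)
      (fun i hi j hij ↦ ?_) z
    obtain ⟨w, hw, hi⟩ := Set.mem_iUnion₂.mp hi
    exact Set.mem_biUnion hw (hclosed w (.inr i) (.inl j) hi hij)
  have hpiece : ∀ w, Nonempty
      (D.piece (⋃ v ∈ Set.Iio w, c₁ v) (⋃ v ∈ Set.Iic w, c₁ v) ≃ₗ[R]
        D'.piece (⋃ v ∈ Set.Iio w, c₂ v) (⋃ v ∈ Set.Iic w, c₂ v)) := by
    intro w
    have hS := IsStable.biUnion hc₁ (Set.Iio w)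
    have hT := IsStable.biUnion hc₁ (Set.Iic w)
    have hS' := IsStable.biUnion hc₂ (Set.Iio w)
    have hT' := IsStable.biUnion hc₂ (Set.Iic w)
    -- The summands new at stage `w` all lie in the countable closure of `w`.
    obtain ⟨s, hs, hs'⟩ := exists_countable_span_piece hS hT (hsub₁ w)
      (((hcount w).preimage Sum.inl_injective).mono (Set.biUnion_Iic_diff_biUnion_Iio_subset c₁ w))
    obtain ⟨t, ht, ht'⟩ := exists_countable_span_piece hS' hT' (hsub₂ w)
      (((hcount w).preimage Sum.inr_injective).mono (Set.biUnion_Iic_diff_biUnion_Iio_subset c₂ w))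
    exact SumRetract.nonempty_linearEquiv_of_countable hJ
      (D.retract _ _ (pieceProj_comp_subtype hS hT (hsub₁ w)))
      (D'.retract _ _ (pieceProj_comp_subtype hS' hT' (hsub₂ w))) hs hs' ht ht'
      (pieceEquiv (AdicCompletion J R) hS hT (hsub₁ w) hS' hT' (hsub₂ w) Φ (hΦ _) (hΦ _)
        (hΨ _) (hΨ _))
  obtain ⟨e₁⟩ := nonempty_directSum_piece_equiv hc₁ fun i ↦ ⟨.inl i, Relation.ReflTransGen.refl⟩
  obtain ⟨e₂⟩ := nonempty_directSum_piece_equiv hc₂ fun i ↦ ⟨.inr i, Relation.ReflTransGen.refl⟩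
  exact ⟨e₁.symm ≪≫ₗ DirectSum.congrLinearEquiv (fun w ↦ (hpiece w).some) ≪≫ₗ e₂⟩

theorem mainTheorem2 (R : Type u) [CommRing R] [IsLocalRing R] [IsNoetherianRing R]
    (P : Type v) [AddCommGroup P] [Module R P] (Q : Type w) [AddCommGroup Q] [Module R Q]
    (hP : IsPureProjective R P) (hQ : IsPureProjective R Q) :
    Nonempty (P ≃ₗ[R] Q) ↔
      Nonempty ((LocalCompletion R ⊗[R] P) ≃ₗ[LocalCompletion R] (LocalCompletion R ⊗[R] Q)) := by
  classical
  constructor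
  · rintro ⟨e⟩
    exact ⟨e.baseChange R (LocalCompletion R) P Q⟩
  · rintro ⟨Φ⟩
    obtain ⟨D⟩ := hP.nonempty_sumRetract
    obtain ⟨D'⟩ := hQ.nonempty_sumRetract
    exact D.nonempty_linearEquiv (IsLocalRing.maximalIdeal_le_jacobson ⊥) D' Φ
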